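/- Let $d\ge 3$ and let $X\subset\mathbb{P}^3$ be a surface of degree $d$ over $\mathbb{C}$, defined by a nonzero homogeneous form $f\in\mathbb{C}[X_0,X_1,X_2,X_3]$ of degree $d$. Let $\operatorname{Sing}(X)$ be the set of points of $X$ at which all partial derivatives of $f$ vanish. A point $P\in X$ is called an $A_k$-singularity of $X$ ($k\ge 1$) if there are formal local coordinates $(z_1,z_2,z_3)$ of $\mathbb{P}^3$ at $P$ in which $X$ is defined by $z_1^2+z_2^2+z_3^{k+1}=0$ (that is, the local equation of $X$ at $P$ equals $z_1^2+z_2^2+z_3^{k+1}$ up to a unit). A smooth point $P$ of $X$ is called a star point of $X$ if the intersection $T_P(X)\cap X$ of $X$ with its embedded tangent plane at $P$ is a plane curve that is a cone with vertex $P$. Let $\Lambda\subset\mathbb{P}^3$ be a line such that $\Lambda\subset X$ and $\Lambda\not\subset\operatorname{Sing}(X)$, and assume that $\Lambda$ contains $d-1$ distinct $A_{d-1}$-singularities of $X$. Then a general point of $\Lambda$ is a star point of $X$; that is, there is a non-empty Zariski open subset of $\Lambda$ all of whose points are star points of $X$. -/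

import Mathlib

open MvPolynomial

noncomputable section

namespace StarPoint

/-- Complex projective three-space, as the space of lines through `0` in `ℂ⁴`. -/
abbrev P3 : Type := Projectivization ℂ (Fin 4 → ℂ)

/-- Homogeneous forms in the coordinates `X₀, X₁, X₂, X₃` live here. The surface `X ⊂ ℙ³` is
represented by a form `f` defining it. -/
abbrev Form : Type := MvPolynomial (Fin 4) ℂ

/-- The point `P` lies on the surface `f = 0`. (For a form `f` this does not depend on the chosen
representative of `P`; the same holds for all the notions below.) -/
def OnSurface (f : Form) (P : P3) : Prop := eval P.rep f = 0

/-- `P ∈ Sing(X)`: the point lies on `X`, and all partial derivatives of `f` vanish at `P`. -/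
def IsSingularPoint (f : Form) (P : P3) : Prop :=
  OnSurface f P ∧ ∀ i, eval P.rep (pderiv i f) = 0

/-- `P` is a smooth point of `X`. -/
def IsSmoothPoint (f : Form) (P : P3) : Prop :=
  OnSurface f P ∧ ∃ i, eval P.rep (pderiv i f) ≠ 0

/-- The linear subspace of `ℂ⁴` given by `∑ i, ∂f/∂X_i(P) X_i = 0`. When `P` is a smooth point of
`X`, its projectivization is the embedded tangent plane `T_P(X)`. -/
def tangentSpace (f : Form) (P : P3) : Submodule ℂ (Fin 4 → ℂ) :=
  LinearMap.ker (∑ i, eval P.rep (pderiv i f) • (LinearMap.proj i : (Fin 4 → ℂ) →ₗ[ℂ] ℂ))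

/-- The hypersurface of `ℙ(W)` cut out by the form `f` (the scheme `ℙ(W) ∩ X`) is a cone with
vertex `P ∈ ℙ(W)`: `f` does not vanish identically on `W`, and `f` restricted to `W` is invariant
under translation by the vectors on the line `P`, that is, in linear coordinates `Y₀, …, Yₘ` on
`W` in which `P = (1 : 0 : ⋯ : 0)`, the equation `f|_W` does not involve `Y₀`. -/
def IsConeWithVertex (f : Form) (W : Submodule ℂ (Fin 4 → ℂ)) (P : P3) : Prop :=
  P.submodule ≤ W ∧ (∃ w ∈ W, eval w f ≠ 0) ∧
    ∀ w ∈ W, ∀ v ∈ P.submodule, eval (w + v) f = eval w f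

/-- `P` is a star point of `X`: it is a smooth point and `T_P(X) ∩ X` is a cone with vertex `P`. -/
def IsStarPoint (f : Form) (P : P3) : Prop :=
  IsSmoothPoint f P ∧ IsConeWithVertex f (tangentSpace f P) P

/-- The equation of `X` in the affine coordinates `x = (x₁, x₂, x₃)` in which the point
`[b₀ + x₁ b₁ + x₂ b₂ + x₃ b₃]` of `ℙ³` has coordinates `x`; the origin is the point `[b₀]`. -/
def affineEquation (f : Form) (b : Module.Basis (Fin 4) ℂ (Fin 4 → ℂ)) :
    MvPolynomial (Fin 3) ℂ :=
  aeval (fun i => C (b 0 i) + ∑ j : Fin 3, C (b j.succ i) * X j) f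

/-- `z` is a system of formal local coordinates at the origin of affine three-space: the `z i` are
power series without constant term, with invertible Jacobian matrix at the origin. -/
def IsLocalCoordinates (z : Fin 3 → MvPowerSeries (Fin 3) ℂ) : Prop :=
  (∀ i, MvPowerSeries.constantCoeff (z i) = 0) ∧
    (Matrix.of fun i j => MvPowerSeries.coeff (Finsupp.single j 1) (z i)).det ≠ 0

/-- `P` is an `A_k`-singularity (`k ≥ 1`) of the surface `X`: in suitable formal local coordinates
`z` at `P`, the surface `X` is defined by `z₁² + z₂² + z₃ ^ (k + 1) = 0`, that is, its equation is
`z₁² + z₂² + z₃ ^ (k + 1)` up to a unit of the ring of power series. -/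
def IsASingularity (k : ℕ) (f : Form) (P : P3) : Prop :=
  ∃ b : Module.Basis (Fin 4) ℂ (Fin 4 → ℂ), b 0 ∈ P.submodule ∧
    ∃ z : Fin 3 → MvPowerSeries (Fin 3) ℂ, IsLocalCoordinates z ∧
      ∃ u : MvPowerSeries (Fin 3) ℂ, IsUnit u ∧
        (affineEquation f b : MvPowerSeries (Fin 3) ℂ) =
          u * (z 0 ^ 2 + z 1 ^ 2 + z 2 ^ (k + 1))

/-- The property `p` holds at a general point of `L`: there is a Zariski open subset `{q ≠ 0}` of
`ℙ³`, with `q` a form, that meets `L` and such that `p` holds at all points of `L` in it. -/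
def HoldsAtGeneralPoint (L : Set P3) (p : P3 → Prop) : Prop :=
  ∃ (q : Form) (n : ℕ), q.IsHomogeneous n ∧ (∃ P ∈ L, eval P.rep q ≠ 0) ∧
    ∀ P ∈ L, eval P.rep q ≠ 0 → p P

end StarPoint

end

/-! Choose linear coordinates in which `Λ` is `X₂ = X₃ = 0`, a point `P₀` of `Λ` smooth on `X` is
`(1:0:0:0)`, and its tangent plane is `X₂ = 0`; let `g` be the equation of `X` in them. On `Λ`,
`∂₂g` and `∂₃g` are forms of degree `d - 1` vanishing at the `d - 1` given singular points. Since
`∂₃g` also vanishes at `P₀`, it vanishes on all of `Λ`: the tangent plane is constantly `X₂ = 0`.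
Since `∂₂g` does not vanish at `P₀`, its `d - 1` zeros are simple, so `∂₀∂₂g ≠ 0` at the singular
points.

An `A_{d-1}`-singularity enters only through the arc `z₁ = z₂ = 0`, along which the equation has
order exactly `d` and its partials order at least `d - 1`. If `g = X₂H + X₃ᵏK` with `2 ≤ k < d`,
these orders and the simplicity of the zeros force `K` to vanish at each singular point
(`coeff_eq_zero_of_hasContactArc`). As `K` has degree `d - k < d - 1`, it vanishes on `Λ`, and a
further factor `X₃` splits off modulo `X₂`. At `k = d` this gives `g = X₂H + cX₃ᵈ`, where `c ≠ 0` by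
the exact contact order (`ne_X_mul_of_hasContactArc`). So the tangent plane section at a smooth
point of `Λ` is the line `Λ` counted `d` times, a cone with vertex any point of `Λ`. -/

namespace StarPoint

/-! ### Orders of vanishing along polynomial arcs -/

section General

variable {σ : Type*}

/-- The chain rule for a derivation applied to a polynomial expression. -/
theorem derivation_aeval [Fintype σ] {A : Type*} [CommRing A] [Algebra ℂ A]
    (D : Derivation ℂ A A) (φ : σ → A) (p : MvPolynomial σ ℂ) :
    D (aeval φ p) = ∑ i, aeval φ (pderiv i p) * D (φ i) := by
  classical
  induction p using MvPolynomial.induction_on with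
  | C a => simp [← algebraMap_eq]
  | add p q hp hq => simp [hp, hq, add_mul, Finset.sum_add_distrib]
  | mul_X p i hp =>
    simp only [map_mul, aeval_X, Derivation.leibniz, hp, pderiv_X, smul_eq_mul, map_add, add_mul,
      Finset.sum_add_distrib, Pi.single_apply, Finset.mul_sum]
    congr 1
    · simp [apply_ite, ite_mul]
    · exact Finset.sum_congr rfl fun j _ => by ring

theorem pow_dvd_aeval_of_mem [Finite σ] {γ : σ → Polynomial ℂ} {m n : ℕ}
    (hγ : ∀ i, Polynomial.X ^ m ∣ γ i) {p : MvPolynomial σ ℂ} (hp : p ∈ idealOfVars σ ℂ ^ n) :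
    Polynomial.X ^ (m * n) ∣ aeval γ p := by
  have h1 : (idealOfVars σ ℂ).map (aeval γ : MvPolynomial σ ℂ →ₐ[ℂ] Polynomial ℂ) ≤
      Ideal.span {Polynomial.X ^ m} := by
    rw [idealOfVars, Ideal.map_span, Ideal.span_le]
    rintro _ ⟨_, ⟨i, rfl⟩, rfl⟩
    simpa [Ideal.mem_span_singleton] using hγ i
  have h2 := Ideal.mem_map_of_mem (aeval γ : MvPolynomial σ ℂ →ₐ[ℂ] Polynomial ℂ) hp
  rw [Ideal.map_pow] at h2
  have h3 := Ideal.pow_right_mono h1 n h2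
  rwa [Ideal.span_singleton_pow, ← pow_mul, Ideal.mem_span_singleton] at h3

theorem mem_idealOfVars_of_constantCoeff {p : MvPolynomial σ ℂ} (hp : constantCoeff p = 0) :
    p ∈ idealOfVars σ ℂ := by
  have := (mem_pow_idealOfVars_iff' 1 p).2 fun x hx => by
    have : x = 0 := (Finsupp.degree_eq_zero_iff x).1 (by omega)
    simpa [this, constantCoeff_eq] using hp
  simpa using this

theorem pderiv_mem_pow_idealOfVars {n : ℕ} {p : MvPolynomial σ ℂ}
    (hp : p ∈ idealOfVars σ ℂ ^ (n + 1)) (i : σ) : pderiv i p ∈ idealOfVars σ ℂ ^ n := by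
  rw [mem_pow_idealOfVars_iff'] at hp ⊢
  intro x hx
  rw [coeff_pderiv, hp _ (by simpa using hx)]
  simp

/-- First-order Taylor expansion. The derivatives may be taken at the origin rather than along `γ`,
because they differ by a multiple of `X`. -/
theorem X_pow_dvd_aeval_add_sub [Fintype σ] {γ δ : σ → Polynomial ℂ} {N : ℕ} (hN : 1 ≤ N)
    (hγ : ∀ i, Polynomial.X ∣ γ i) (hδ : ∀ i, Polynomial.X ^ N ∣ δ i) (p : MvPolynomial σ ℂ) :
    Polynomial.X ^ (N + 1) ∣ aeval (γ + δ) p - aeval γ p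
      - ∑ i, Polynomial.C (eval 0 (pderiv i p)) * δ i := by
  classical
  induction p using MvPolynomial.induction_on with
  | C a => simp
  | add p q hp hq =>
    convert dvd_add hp hq using 1
    simp only [map_add, add_mul, Finset.sum_add_distrib]
    ring
  | mul_X p j hp =>
    have h1 : Polynomial.X ^ N ∣ aeval (γ + δ) p - aeval γ p := by
      have h2 := (pow_dvd_pow Polynomial.X (Nat.le_succ N)).trans hp
      have h3 : Polynomial.X ^ N ∣ ∑ i, Polynomial.C (eval 0 (pderiv i p)) * δ i :=
        Finset.dvd_sum fun i _ => (hδ i).mul_left _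
      simpa using dvd_add h2 h3
    have h2 : Polynomial.X ∣ aeval γ p - Polynomial.C (eval 0 p) := by
      have := pow_dvd_aeval_of_mem (m := 1) (n := 1) (fun i => by simpa using hγ i)
        (p := p - C (eval 0 p)) (by
          rw [pow_one]
          exact mem_idealOfVars_of_constantCoeff (by simp))
      simpa using this
    have h3 : Polynomial.X ∣ (γ + δ) j :=
      dvd_add (hγ j) ((dvd_pow_self _ (by omega)).trans (hδ j))
    have h4 : ∑ i, Polynomial.C (eval 0 (pderiv i (p * X j))) * δ i =
        Polynomial.C (eval 0 p) * δ j := by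
      simp [Pi.single_apply, apply_ite, ite_mul]
    rw [h4]
    have e : aeval (γ + δ) (p * X j) - aeval γ (p * X j) - Polynomial.C (eval 0 p) * δ j =
        (aeval (γ + δ) p - aeval γ p) * (γ + δ) j
          + δ j * (aeval γ p - Polynomial.C (eval 0 p)) := by
      simp; ring
    rw [e, pow_succ]
    exact dvd_add (mul_dvd_mul h1 h3) (mul_dvd_mul (hδ j) h2)

/-- Newton iteration: a polynomial map without constant terms and with invertible Jacobian matrix
at the origin can be inverted along any arc through the origin, to any finite order. -/
theorem exists_arc_of_det_ne_zero [Fintype σ] [DecidableEq σ] (Z : σ → MvPolynomial σ ℂ)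
    (hZ : ∀ i, constantCoeff (Z i) = 0)
    (hJ : (Matrix.of fun i j => eval 0 (pderiv j (Z i))).det ≠ 0)
    (τ : σ → Polynomial ℂ) (hτ : ∀ i, Polynomial.X ∣ τ i) (N : ℕ) :
    ∃ γ : σ → Polynomial ℂ, (∀ i, Polynomial.X ∣ γ i) ∧
      ∀ i, Polynomial.X ^ (N + 1) ∣ aeval γ (Z i) - τ i := by
  induction N with
  | zero =>
    refine ⟨0, by simp, fun i => ?_⟩
    have : aeval (0 : σ → Polynomial ℂ) (Z i) = 0 := by
      rw [aeval_zero, hZ, map_zero]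
    simpa [this] using hτ i
  | succ N ih =>
    obtain ⟨γ, hγ, h⟩ := ih
    choose r hr using h
    set J : Matrix σ σ ℂ := Matrix.of fun i j => eval 0 (pderiv j (Z i)) with hJd
    set v : σ → ℂ := J⁻¹.mulVec fun i => -(r i).coeff 0 with hv
    -- There is no `STEP` beyond the Newton correction: `v` solves the linearized equation for the
    -- coefficient of `X ^ (N + 1)` in the error.
    have hJv : J.mulVec v = fun i => -(r i).coeff 0 := by
      rw [hv, Matrix.mulVec_mulVec, Matrix.mul_nonsing_inv _ (isUnit_iff_ne_zero.2 hJ),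
        Matrix.one_mulVec]
    obtain ⟨δ, hδv⟩ : ∃ δ : σ → Polynomial ℂ,
        ∀ i, δ i = Polynomial.X ^ (N + 1) * Polynomial.C (v i) := ⟨_, fun _ => rfl⟩
    have hδ : ∀ i, Polynomial.X ^ (N + 1) ∣ δ i := fun i => hδv i ▸ dvd_mul_right _ _
    refine ⟨γ + δ, fun i => ?_, fun i => ?_⟩
    · exact dvd_add (hγ i) ((dvd_pow_self _ N.succ_ne_zero).trans (hδ i))
    · have h1 := X_pow_dvd_aeval_add_sub (by omega) hγ hδ (Z i)
      have h2 : ∑ j, Polynomial.C (eval 0 (pderiv j (Z i))) * δ j =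
          Polynomial.X ^ (N + 1) * Polynomial.C (-(r i).coeff 0) := by
        rw [← congrFun hJv i, Matrix.mulVec, dotProduct, map_sum, Finset.mul_sum]
        refine Finset.sum_congr rfl fun j _ => ?_
        rw [hδv, map_mul]
        simp only [hJd, Matrix.of_apply]
        ring
      rw [h2] at h1
      have h3 : Polynomial.X ^ (N + 1 + 1) ∣
          Polynomial.X ^ (N + 1) * (r i + Polynomial.C (-(r i).coeff 0)) := by
        rw [pow_succ]
        exact mul_dvd_mul_left _ (by simp [Polynomial.X_dvd_iff])
      convert dvd_add h1 h3 using 1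
      rw [mul_add, ← hr i]; ring

end General

/-! ### Arcs through an `A_{d-1}`-singularity -/

theorem eval_zero_pderiv {σ : Type*} (p : MvPolynomial σ ℂ) (j : σ) :
    eval 0 (pderiv j p) = coeff (Finsupp.single j 1) p := by
  have : eval 0 (pderiv j p) = coeff 0 (pderiv j p) := by
    rw [← constantCoeff_eq]; simp
  rw [this, coeff_pderiv]; simp

/-- An `A_{d-1}`-singularity is touched to order `d` by an arc along which the partial derivatives
of the equation vanish to order `d - 1`. -/
theorem exists_arc_of_normalForm {d : ℕ} (hd : 2 ≤ d) (F : MvPolynomial (Fin 3) ℂ)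
    (z : Fin 3 → MvPowerSeries (Fin 3) ℂ) (hz : IsLocalCoordinates z)
    (u : MvPowerSeries (Fin 3) ℂ) (hu : IsUnit u)
    (hF : (F : MvPowerSeries (Fin 3) ℂ) = u * (z 0 ^ 2 + z 1 ^ 2 + z 2 ^ d)) :
    ∃ γ : Fin 3 → Polynomial ℂ, (∀ i, Polynomial.X ∣ γ i) ∧ (¬ ∀ i, Polynomial.X ^ 2 ∣ γ i) ∧
      Polynomial.X ^ d ∣ aeval γ F ∧ ¬ Polynomial.X ^ (d + 1) ∣ aeval γ F ∧
      ∀ j, Polynomial.X ^ (d - 1) ∣ aeval γ (pderiv j F) := by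
  -- Only orders up to `d` matter, so coordinates and unit are replaced by polynomials, keeping the
  -- terms of degree at most `d`.
  set Z : Fin 3 → MvPolynomial (Fin 3) ℂ := fun i => (z i).truncTotal (d + 1) with hZdef
  set U : MvPolynomial (Fin 3) ℂ := u.truncTotal (d + 1) with hUdef
  set Q : MvPolynomial (Fin 3) ℂ := Z 0 ^ 2 + Z 1 ^ 2 + Z 2 ^ d with hQ
  have hZ0 : ∀ i, constantCoeff (Z i) = 0 := fun i => by
    rw [hZdef, MvPowerSeries.constantCoeff_truncTotal_eq_ite, hz.1 i, ite_self]
  have hU0 : constantCoeff U ≠ 0 := by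
    rw [hUdef, MvPowerSeries.constantCoeff_truncTotal_eq_ite, if_pos (Nat.succ_pos d)]
    exact (hu.map MvPowerSeries.constantCoeff).ne_zero
  have hJ : (Matrix.of fun i j => eval 0 (pderiv j (Z i))).det ≠ 0 := by
    convert hz.2 using 4 with i
    ext j
    rw [eval_zero_pderiv, hZdef, MvPowerSeries.coeff_truncTotal]
    simp; omega
  have hG : F - U * Q ∈ idealOfVars (Fin 3) ℂ ^ (d + 1) := by
    have h := congrArg (MvPowerSeries.truncTotalAlgHom (Fin 3) ℂ (d + 1)) hF
    simp only [map_mul, map_add, map_pow] at h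
    have h1 : MvPowerSeries.truncTotalAlgHom (Fin 3) ℂ (d + 1) (F : MvPowerSeries (Fin 3) ℂ) =
        Ideal.Quotient.mk _ F := (MvPowerSeries.truncTotalAlgHom (Fin 3) ℂ (d + 1)).commutes F
    rw [h1] at h
    rw [← Ideal.Quotient.eq, h, hQ]
    simp only [map_mul, map_add, map_pow]
    rfl
  -- The arc is the `z₃`-axis, up to order `d`.
  obtain ⟨γ, hγ, hγZ⟩ := exists_arc_of_det_ne_zero Z hZ0 hJ ![0, 0, Polynomial.X]
    (by intro i; fin_cases i <;> simp) d
  have hγ0 : Polynomial.X ^ (d + 1) ∣ aeval γ (Z 0) := by simpa using hγZ 0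
  have hγ1 : Polynomial.X ^ (d + 1) ∣ aeval γ (Z 1) := by simpa using hγZ 1
  have hγ2 : Polynomial.X ^ (d + 1) ∣ aeval γ (Z 2) - Polynomial.X := by simpa using hγZ 2
  have hγ1' : ∀ i, Polynomial.X ^ 1 ∣ γ i := fun i => by simpa using hγ i
  have hX2 : Polynomial.X ∣ aeval γ (Z 2) := by
    have := ((dvd_pow_self Polynomial.X d.succ_ne_zero).trans hγ2).add (dvd_refl Polynomial.X)
    simpa using this
  have hQd : Polynomial.X ^ (d + 1) ∣ aeval γ Q - Polynomial.X ^ d := by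
    have e : aeval γ Q - Polynomial.X ^ d = aeval γ (Z 0) ^ 2 + aeval γ (Z 1) ^ 2
        + (aeval γ (Z 2) ^ d - Polynomial.X ^ d) := by simp [hQ]; ring
    rw [e]
    exact dvd_add (dvd_add (hγ0.trans (dvd_pow_self _ two_ne_zero))
      (hγ1.trans (dvd_pow_self _ two_ne_zero))) (hγ2.trans (sub_dvd_pow_sub_pow _ _ d))
  have hGd : Polynomial.X ^ (d + 1) ∣ aeval γ F - aeval γ U * aeval γ Q := by
    simpa using pow_dvd_aeval_of_mem hγ1' hG
  have hQd' : Polynomial.X ^ d ∣ aeval γ Q := by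
    simpa using dvd_add ((pow_dvd_pow _ d.le_succ).trans hQd) (dvd_refl (Polynomial.X ^ d))
  refine ⟨γ, hγ, fun h => ?_, ?_, fun h => ?_, fun j => ?_⟩
  · have h1 := pow_dvd_aeval_of_mem (n := 1) h
      (by simpa using mem_idealOfVars_of_constantCoeff (hZ0 2))
    have h2 := dvd_sub h1 ((pow_dvd_pow Polynomial.X (by omega : 2 * 1 ≤ d + 1)).trans hγ2)
    rw [sub_sub_cancel] at h2
    have h3 := (Polynomial.X_pow_dvd_iff.1 h2) 1 (by norm_num)
    simp at h3
  · have h := dvd_add ((pow_dvd_pow _ d.le_succ).trans hGd) (hQd'.mul_left (aeval γ U))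
    simpa using h
  · have h1 : Polynomial.X ^ (d + 1) ∣ aeval γ U * Polynomial.X ^ d := by
      have e : aeval γ U * Polynomial.X ^ d = aeval γ F - (aeval γ F - aeval γ U * aeval γ Q)
        - aeval γ U * (aeval γ Q - Polynomial.X ^ d) := by ring
      rw [e]
      exact dvd_sub (dvd_sub h hGd) (hQd.mul_left _)
    rw [mul_comm, pow_succ] at h1
    have h2 : Polynomial.X ∣ aeval γ U :=
      (mul_dvd_mul_iff_left (pow_ne_zero d Polynomial.X_ne_zero)).1 h1
    have h3 : Polynomial.X ∣ aeval γ U - Polynomial.C (constantCoeff U) := by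
      have := pow_dvd_aeval_of_mem (n := 1) hγ1' (p := U - C (constantCoeff U))
        (by simpa using mem_idealOfVars_of_constantCoeff (p := U - C (constantCoeff U)) (by simp))
      simpa using this
    have h4 := dvd_sub h2 h3
    rw [sub_sub_cancel, Polynomial.X_dvd_iff, Polynomial.coeff_C_zero] at h4
    exact hU0 h4
  · have h1 : Polynomial.X ^ d ∣ aeval γ (pderiv j (F - U * Q)) := by
      simpa using pow_dvd_aeval_of_mem hγ1' (pderiv_mem_pow_idealOfVars hG j)
    have h2 : Polynomial.X ^ (d - 1) ∣ aeval γ (pderiv j Q) := by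
      simp only [hQ, map_add, pderiv_pow, map_mul, map_pow, map_natCast]
      have hle : d - 1 ≤ d + 1 := by omega
      refine dvd_add (dvd_add ?_ ?_) ?_
      · simpa using (((pow_dvd_pow _ hle).trans hγ0).mul_left 2).mul_right _
      · simpa using (((pow_dvd_pow _ hle).trans hγ1).mul_left 2).mul_right _
      · exact ((pow_dvd_pow_of_dvd hX2 (d - 1)).mul_left _).mul_right _
    have e : aeval γ (pderiv j F) = aeval γ (pderiv j (F - U * Q))
        + (aeval γ (pderiv j U) * aeval γ Q + aeval γ U * aeval γ (pderiv j Q)) := by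
      simp; ring
    rw [e]
    have hle : d - 1 ≤ d := by omega
    exact dvd_add ((pow_dvd_pow _ hle).trans h1)
      (dvd_add (((pow_dvd_pow _ hle).trans hQd').mul_left _) (h2.mul_left _))

/-- An arc through the point `p` of affine four-space that is not tangent to the line through the
origin and `p`, and that touches the cone `g = 0` to order exactly `d`, while the partial
derivatives of `g` vanish along it to order `d - 1`. -/
def HasContactArc (d : ℕ) (g : Form) (p : Fin 4 → ℂ) : Prop :=
  ∃ γ : Fin 4 → Polynomial ℂ, (∀ i, (γ i).coeff 0 = p i) ∧
    (∀ c : ℂ, ¬ ∀ i, (γ i).coeff 1 = c * p i) ∧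
    Polynomial.X ^ d ∣ aeval γ g ∧ ¬ Polynomial.X ^ (d + 1) ∣ aeval γ g ∧
    ∀ i, Polynomial.X ^ (d - 1) ∣ aeval γ (pderiv i g)

/-- The affine partials are the derivatives of `g` in the directions `b 1`, `b 2`, `b 3`. Euler's
relation supplies the direction `b 0`, and together they control all the partials of `g`. -/
theorem hasContactArc_of_affineEquation {d : ℕ} (hd : 2 ≤ d) {g : Form} (hg : g.IsHomogeneous d)
    (b : Module.Basis (Fin 4) ℂ (Fin 4 → ℂ)) (z : Fin 3 → MvPowerSeries (Fin 3) ℂ)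
    (hz : IsLocalCoordinates z) (u : MvPowerSeries (Fin 3) ℂ) (hu : IsUnit u)
    (hF : (affineEquation g b : MvPowerSeries (Fin 3) ℂ) =
      u * (z 0 ^ 2 + z 1 ^ 2 + z 2 ^ d)) :
    HasContactArc d g (b 0) := by
  obtain ⟨γ, hγ, hγ2, hFd, hFd', hFp⟩ := exists_arc_of_normalForm hd _ z hz u hu hF
  set Γ : Fin 4 → Polynomial ℂ :=
    fun i => Polynomial.C (b 0 i) + ∑ j : Fin 3, Polynomial.C (b j.succ i) * γ j with hΓ
  have comp : ∀ p : Form, aeval γ (aeval (fun i => (C (b 0 i) + ∑ j : Fin 3, C (b j.succ i) * X j :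
      MvPolynomial (Fin 3) ℂ)) p) = aeval Γ p := fun p => by
    rw [← AlgHom.comp_apply]
    congr 1
    ext i : 1
    simp [hΓ]
  have hγ0 : ∀ j, (γ j).coeff 0 = 0 := fun j => Polynomial.X_dvd_iff.1 (hγ j)
  rw [affineEquation, comp] at hFd hFd'
  have hD : ∀ j : Fin 3, Polynomial.X ^ (d - 1) ∣
      ∑ i, Polynomial.C (b j.succ i) * aeval Γ (pderiv i g) := fun j => by
    have h := hFp j
    rw [affineEquation, derivation_aeval, map_sum] at h
    convert h using 2 with i
    rw [map_mul, comp, mul_comm]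
    congr 1
    simp [Pi.single_apply]
  have hE : ∑ i, Γ i * aeval Γ (pderiv i g) = d • aeval Γ g := by
    have := congrArg (aeval Γ) hg.sum_X_mul_pderiv
    simpa using this
  have hD0 : Polynomial.X ^ (d - 1) ∣ ∑ i, Polynomial.C (b 0 i) * aeval Γ (pderiv i g) := by
    have e : ∑ i, Polynomial.C (b 0 i) * aeval Γ (pderiv i g) = d • aeval Γ g -
        ∑ j : Fin 3, γ j * ∑ i, Polynomial.C (b j.succ i) * aeval Γ (pderiv i g) := by
      rw [← hE, eq_sub_iff_add_eq]
      simp only [hΓ, add_mul, Finset.sum_add_distrib, Finset.sum_mul, Finset.mul_sum]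
      congr 1
      rw [Finset.sum_comm]
      exact Finset.sum_congr rfl fun i _ => Finset.sum_congr rfl fun j _ => by ring
    rw [e]
    refine dvd_sub (dvd_nsmul_of_dvd _ ((pow_dvd_pow _ (by omega)).trans hFd))
      (Finset.dvd_sum fun j _ => (hD j).mul_left _)
  refine ⟨Γ, fun i => ?_, fun c hc => ?_, hFd, hFd', fun i => ?_⟩
  · simp [hΓ, hγ0]
  -- The velocity of the arc is a combination of `b 1`, `b 2`, `b 3` only; being proportional to `b
  -- 0` would make it zero.
  · have h1 : (-c) • b 0 + ∑ j : Fin 3, (γ j).coeff 1 • b j.succ = 0 := by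
      ext i
      have := hc i
      simp only [hΓ, Polynomial.coeff_add, Polynomial.finsetSum_coeff,
        Polynomial.coeff_C_mul, Polynomial.coeff_C_succ, zero_add] at this
      simp [Finset.sum_apply, ← this, mul_comm]
    have h2 := Fintype.linearIndependent_iff.1 b.linearIndependent
      (Fin.cons (-c) fun j => (γ j).coeff 1) (by rw [Fin.sum_univ_succ]; simpa using h1)
    refine hγ2 fun j => Polynomial.X_pow_dvd_iff.2 fun m hm => ?_
    interval_cases m
    · exact hγ0 j
    · simpa using h2 j.succ
  · have hDall : ∀ k, Polynomial.X ^ (d - 1) ∣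
        ∑ i, Polynomial.C (b k i) * aeval Γ (pderiv i g) := Fin.cases hD0 hD
    have hi : ∀ j, ∑ k, b.repr (Pi.single i 1) k * b k j = (Pi.single i 1 : Fin 4 → ℂ) j :=
      fun j => by simpa [Finset.sum_apply] using congrFun (b.sum_repr (Pi.single i 1)) j
    have e : aeval Γ (pderiv i g) = ∑ k, Polynomial.C (b.repr (Pi.single i 1) k) *
        ∑ j, Polynomial.C (b k j) * aeval Γ (pderiv j g) := by
      simp only [Finset.mul_sum]
      rw [Finset.sum_comm]
      simp only [← mul_assoc, ← Finset.sum_mul, ← map_mul, ← map_sum, hi]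
      simp [Pi.single_apply]
    rw [e]
    exact Finset.dvd_sum fun k _ => (hDall k).mul_left _

/-! ### Constraints imposed by a contact arc -/

theorem coeff_zero_aeval {σ : Type*} (γ : σ → Polynomial ℂ) (p : MvPolynomial σ ℂ) :
    (aeval γ p).coeff 0 = eval (fun i => (γ i).coeff 0) p := by
  rw [← Polynomial.constantCoeff_apply, ← RingHom.coe_coe (aeval γ), ← RingHom.comp_apply]
  congr 1
  ext <;> simp

theorem coeff_one_aeval {σ : Type*} [Fintype σ] (γ : σ → Polynomial ℂ) (p : MvPolynomial σ ℂ) :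
    (aeval γ p).coeff 1 =
      ∑ i, eval (fun i => (γ i).coeff 0) (pderiv i p) * (γ i).coeff 1 := by
  have h := congrArg (fun q => Polynomial.coeff q 0) (derivation_aeval Polynomial.derivative' γ p)
  simpa [Polynomial.mul_coeff_zero, Polynomial.coeff_derivative, coeff_zero_aeval,
    Polynomial.finsetSum_coeff] using h

theorem eval_smul_of_isHomogeneous {σ : Type*} {n : ℕ} {q : MvPolynomial σ ℂ}
    (hq : q.IsHomogeneous n) (c : ℂ) (x : σ → ℂ) : eval (c • x) q = c ^ n * eval x q := by
  rw [eval_eq, eval_eq, Finset.mul_sum]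
  refine Finset.sum_congr rfl fun m hm => ?_
  simp only [Pi.smul_apply, smul_eq_mul, mul_pow, Finset.prod_mul_distrib]
  rw [Finset.prod_pow_eq_pow_sum, ← hq.degree_eq_sum_deg_support hm]
  ring

/-- Along the arc, `∂₀g` forces order `k` on `X₂`, then `∂₂g` forces it on `H`, so `X₃ᵏK` has order
at least `k + 1`. If `K ≠ 0` at the point, `X₃` has order at least 2 and the arc is tangent to the
plane over the line `X₂ = X₃ = 0`. Its velocity and the point itself are then both killed by the
nonzero differential of `H` on that plane, hence proportional, which is excluded. -/
theorem coeff_eq_zero_of_hasContactArc {d k : ℕ} (hk : 2 ≤ k) (hkd : k < d) {g H K : Form}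
    (hg : g.IsHomogeneous d) (hgHK : g = X 2 * H + X 3 ^ k * K) {a b : ℂ} (hb : b ≠ 0)
    (harc : HasContactArc d g ![a, b, 0, 0])
    (hA : eval ![a, b, 0, 0] (pderiv 0 (pderiv 2 g)) ≠ 0) : eval ![a, b, 0, 0] K = 0 := by
  obtain ⟨γ, hγ0, hγ1, hgd, -, hgp⟩ := harc
  have hγ : (fun i => (γ i).coeff 0) = ![a, b, 0, 0] := funext hγ0
  have h2g : pderiv 2 g = H + X 2 * pderiv 2 H + X 3 ^ k * pderiv 2 K := by
    rw [hgHK]; simp [pderiv_X]; ring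
  have h02 : pderiv 0 (pderiv 2 g) = pderiv 0 H + X 2 * pderiv 0 (pderiv 2 H)
      + X 3 ^ k * pderiv 0 (pderiv 2 K) := by
    rw [h2g]; simp [pderiv_X]
  have h12 : pderiv 1 (pderiv 2 g) = pderiv 1 H + X 2 * pderiv 1 (pderiv 2 H)
      + X 3 ^ k * pderiv 1 (pderiv 2 K) := by
    rw [h2g]; simp [pderiv_X]
  have h0g : pderiv 0 g = X 2 * pderiv 0 H + X 3 ^ k * pderiv 0 K := by
    rw [hgHK]; simp [pderiv_X]
  have hk0 : k ≠ 0 := by omega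
  have hA0 : eval ![a, b, 0, 0] (pderiv 0 (pderiv 2 g)) = eval ![a, b, 0, 0] (pderiv 0 H) := by
    rw [h02]; simp [hk0]
  have hB0 : eval ![a, b, 0, 0] (pderiv 1 (pderiv 2 g)) = eval ![a, b, 0, 0] (pderiv 1 H) := by
    rw [h12]; simp [hk0]
  have hx3 : Polynomial.X ∣ γ 3 := by rw [Polynomial.X_dvd_iff, hγ0]; rfl
  have hx3k : Polynomial.X ^ k ∣ γ 3 ^ k := pow_dvd_pow_of_dvd hx3 k
  have hkd' : k ≤ d - 1 := by omega
  -- the third coordinate vanishes to order `k`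
  have hx2 : Polynomial.X ^ k ∣ γ 2 := by
    have h1 : Polynomial.X ^ k ∣ γ 2 * aeval γ (pderiv 0 H) := by
      have h := (pow_dvd_pow _ hkd').trans (hgp 0)
      rw [h0g] at h
      simp only [map_add, map_mul, map_pow, aeval_X] at h
      exact (dvd_add_left (hx3k.mul_right _)).1 h
    refine (Polynomial.prime_X.pow_dvd_of_dvd_mul_right k ?_ h1)
    rw [Polynomial.X_dvd_iff, coeff_zero_aeval, hγ, ← hA0]
    exact hA
  have hHk : Polynomial.X ^ k ∣ aeval γ H := by
    have h := (pow_dvd_pow _ hkd').trans (hgp 2)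
    rw [h2g] at h
    simp only [map_add, map_mul, map_pow, aeval_X] at h
    exact (dvd_add_left (hx2.mul_right _)).1 ((dvd_add_left (hx3k.mul_right _)).1 h)
  have hK : Polynomial.X ^ (k + 1) ∣ γ 3 ^ k * aeval γ K := by
    have h := (pow_dvd_pow Polynomial.X (by omega : k + 1 ≤ d)).trans hgd
    have h2 : Polynomial.X ^ (k + 1) ∣ γ 2 * aeval γ H := by
      refine (pow_dvd_pow Polynomial.X (by omega : k + 1 ≤ k + k)).trans ?_
      rw [pow_add]
      exact mul_dvd_mul hx2 hHk
    have e : aeval γ g = γ 2 * aeval γ H + γ 3 ^ k * aeval γ K := by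
      rw [hgHK]; simp
    rw [e] at h
    exact (dvd_add_right h2).1 h
  by_contra hKne
  have hx3' : Polynomial.X ^ 2 ∣ γ 3 := by
    have h1 : Polynomial.X ^ (k + 1) ∣ γ 3 ^ k := by
      refine Polynomial.prime_X.pow_dvd_of_dvd_mul_right _ ?_ hK
      rw [Polynomial.X_dvd_iff, coeff_zero_aeval, hγ]
      exact hKne
    obtain ⟨r, hr⟩ := hx3
    rw [hr, mul_pow, pow_succ, mul_dvd_mul_iff_left (pow_ne_zero k Polynomial.X_ne_zero)] at h1
    rw [hr, pow_two]
    exact mul_dvd_mul_left _ (Polynomial.prime_X.dvd_of_dvd_pow h1)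
  have hx2' : Polynomial.X ^ 2 ∣ γ 2 := (pow_dvd_pow _ hk).trans hx2
  have hlin : eval ![a, b, 0, 0] (pderiv 0 H) * (γ 0).coeff 1
      + eval ![a, b, 0, 0] (pderiv 1 H) * (γ 1).coeff 1 = 0 := by
    have h1 := coeff_one_aeval γ H
    rw [Polynomial.X_pow_dvd_iff.1 ((pow_dvd_pow Polynomial.X hk).trans hHk) 1 one_lt_two,
      hγ, Fin.sum_univ_four, Polynomial.X_pow_dvd_iff.1 hx2' 1 one_lt_two,
      Polynomial.X_pow_dvd_iff.1 hx3' 1 one_lt_two] at h1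
    linear_combination -h1
  -- Euler's relation for `∂₂g`, which vanishes at the point.
  have hEuler : a * eval ![a, b, 0, 0] (pderiv 0 H) + b * eval ![a, b, 0, 0] (pderiv 1 H) = 0 := by
    have h1 := congrArg (eval ![a, b, 0, 0]) (hg.pderiv (i := 2)).sum_X_mul_pderiv
    have h2 : eval ![a, b, 0, 0] (pderiv 2 g) = 0 := by
      rw [← hγ, ← coeff_zero_aeval, ← Polynomial.X_dvd_iff]
      exact (dvd_pow_self _ (by omega)).trans (hgp 2)
    rw [map_nsmul, h2, smul_zero, map_sum, Fin.sum_univ_four] at h1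
    simpa [hA0, hB0] using h1
  rw [hA0] at hA
  have h01 : b * (γ 0).coeff 1 = a * (γ 1).coeff 1 := by
    apply mul_left_cancel₀ hA
    linear_combination b * hlin - (γ 1).coeff 1 * hEuler
  refine hγ1 ((γ 1).coeff 1 / b) fun i => ?_
  fin_cases i
  · show (γ 0).coeff 1 = (γ 1).coeff 1 / b * a
    field_simp
    linear_combination h01
  · show (γ 1).coeff 1 = (γ 1).coeff 1 / b * b
    field_simp
  · show (γ 2).coeff 1 = (γ 1).coeff 1 / b * 0
    rw [Polynomial.X_pow_dvd_iff.1 hx2' 1 one_lt_two, mul_zero]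
  · show (γ 3).coeff 1 = (γ 1).coeff 1 / b * 0
    rw [Polynomial.X_pow_dvd_iff.1 hx3' 1 one_lt_two, mul_zero]

/-- Otherwise `X₂` and `H` would both have order at least `d - 1` along the arc, and `2(d - 1) ≥ d +
1` contradicts contact of order exactly `d`. -/
theorem ne_X_mul_of_hasContactArc {d : ℕ} (hd : 3 ≤ d) {g H : Form} {a b : ℂ}
    (harc : HasContactArc d g ![a, b, 0, 0])
    (hA : eval ![a, b, 0, 0] (pderiv 0 (pderiv 2 g)) ≠ 0) : g ≠ X 2 * H := by
  rintro rfl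
  obtain ⟨γ, hγ0, -, -, hgd, hgp⟩ := harc
  have hγ : (fun i => (γ i).coeff 0) = ![a, b, 0, 0] := funext hγ0
  have h2 : pderiv 2 (X 2 * H) = H + X 2 * pderiv 2 H := by simp; ring
  have h0 : pderiv 0 (X 2 * H) = X 2 * pderiv 0 H := by simp [pderiv_X]
  have hA' : eval ![a, b, 0, 0] (pderiv 0 H) ≠ 0 := by
    rw [h2] at hA; simpa [pderiv_mul, pderiv_X] using hA
  have hx2 : Polynomial.X ^ (d - 1) ∣ γ 2 := by
    have h := hgp 0
    rw [h0, map_mul, aeval_X] at h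
    refine Polynomial.prime_X.pow_dvd_of_dvd_mul_right _ ?_ h
    rwa [Polynomial.X_dvd_iff, coeff_zero_aeval, hγ]
  have hH : Polynomial.X ^ (d - 1) ∣ aeval γ H := by
    have h := hgp 2
    rw [h2, map_add, map_mul, aeval_X] at h
    exact (dvd_add_left (hx2.mul_right _)).1 h
  refine hgd ((pow_dvd_pow Polynomial.X (by omega : d + 1 ≤ (d - 1) + (d - 1))).trans ?_)
  rw [pow_add, map_mul, aeval_X]
  exact mul_dvd_mul hx2 hH

/-! ### Forms restricted to the line, and the shape of the equation -/

/-- The dehomogenized restriction of a form to the line `X₂ = X₃ = 0`. -/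
noncomputable def lineRestriction : Form →ₐ[ℂ] Polynomial ℂ := aeval ![Polynomial.X, 1, 0, 0]

theorem eval_lineRestriction (q : Form) (t : ℂ) :
    (lineRestriction q).eval t = eval ![t, 1, 0, 0] q := by
  rw [lineRestriction, ← Polynomial.coe_evalRingHom, ← RingHom.coe_coe (aeval _),
    ← RingHom.comp_apply]
  congr 1
  ext i
  · simp
  · fin_cases i <;> simp

theorem derivative_lineRestriction (q : Form) :
    (lineRestriction q).derivative = lineRestriction (pderiv 0 q) := by
  have h := derivation_aeval Polynomial.derivative' ![Polynomial.X, 1, 0, 0] q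
  simpa [Fin.sum_univ_four, lineRestriction] using h

theorem natDegree_lineRestriction_le {q : Form} {n : ℕ} (hq : q.IsHomogeneous n) :
    (lineRestriction q).natDegree ≤ n := by
  have := aeval_natDegree_le (n := 1) q hq.totalDegree_le ![Polynomial.X, 1, 0, 0]
    (by intro i; fin_cases i <;> simp)
  simpa [lineRestriction] using this

/-- Accounts for the point at infinity `(1:0:0:0)`: a zero there lowers the degree of the
restriction. -/
theorem coeff_lineRestriction {q : Form} {n : ℕ} (hq : q.IsHomogeneous n) :
    (lineRestriction q).coeff n = eval ![1, 0, 0, 0] q := by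
  rw [lineRestriction, aeval_def, eval₂_eq', eval_eq', Polynomial.finsetSum_coeff]
  refine Finset.sum_congr rfl fun m hm => ?_
  have hdeg : n = m.degree := hq.degree_eq_sum_deg_support hm
  rw [Finsupp.degree_eq_sum, Fin.sum_univ_four] at hdeg
  simp only [Polynomial.algebraMap_eq, Polynomial.coeff_C_mul, Fin.prod_univ_four]
  congr 1
  rcases eq_or_ne (m 2) 0 with h2 | h2
  · rcases eq_or_ne (m 3) 0 with h3 | h3
    · rcases eq_or_ne (m 1) 0 with h1 | h1
      · have : n = m 0 := by omega
        simp [h1, h2, h3, this]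
      · have : n ≠ m 0 := by omega
        simp [h1, h2, h3, Polynomial.coeff_X_pow, this]
    · simp [h3]
  · simp [h2]

theorem mem_span_X_of_lineRestriction_eq_zero {q : Form} {n : ℕ} (hq : q.IsHomogeneous n)
    (h : lineRestriction q = 0) : q ∈ Ideal.span {X 2, X 3} := by
  -- The factor `X 1` disposes of the points with `x 1 = 0`, which the dehomogenization does not
  -- see.
  have h1 : (X 1 : Form) * aeval ![X 0, X 1, 0, 0] q = 0 := by
    apply MvPolynomial.funext
    intro x
    have e : eval x (aeval ![X 0, X 1, 0, 0] q) = eval ![x 0, x 1, 0, 0] q := by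
      rw [← RingHom.coe_coe (aeval _), ← RingHom.comp_apply]
      congr 1
      ext i
      · simp
      · fin_cases i <;> simp
    rw [map_mul, e, eval_X, map_zero]
    rcases eq_or_ne (x 1) 0 with hx | hx
    · simp [hx]
    · have e2 : (![x 0, x 1, 0, 0] : Fin 4 → ℂ) = x 1 • ![x 0 / x 1, 1, 0, 0] := by
        simp [Matrix.smul_cons]; field_simp
      rw [e2, eval_smul_of_isHomogeneous hq, ← eval_lineRestriction, h]
      simp
  have h2 : (aeval ![X 0, X 1, 0, 0] q : Form) = 0 := (mul_eq_zero.1 h1).resolve_left (X_ne_zero 1)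
  set I : Ideal Form := Ideal.span {X 2, X 3} with hI
  have h3 : (Ideal.Quotient.mkₐ ℂ I).comp (aeval ![X 0, X 1, 0, 0]) = Ideal.Quotient.mkₐ ℂ I := by
    ext i
    fin_cases i
    · simp
    · simp
    · simpa using (Ideal.Quotient.eq_zero_iff_mem.2
        (Ideal.subset_span (by simp) : (X 2 : Form) ∈ I)).symm
    · simpa using (Ideal.Quotient.eq_zero_iff_mem.2
        (Ideal.subset_span (by simp) : (X 3 : Form) ∈ I)).symm
  have h4 := AlgHom.congr_fun h3 q
  rw [AlgHom.comp_apply, h2, map_zero] at h4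
  exact Ideal.Quotient.eq_zero_iff_mem.1 h4.symm

theorem homogeneousComponent_succ_X_mul {σ : Type*} (i : σ) (p : MvPolynomial σ ℂ) (n : ℕ) :
    homogeneousComponent (n + 1) (X i * p) = X i * homogeneousComponent n p := by
  classical
  ext m
  rw [coeff_homogeneousComponent, coeff_X_mul', coeff_X_mul', coeff_homogeneousComponent]
  by_cases hm : i ∈ m.support
  · simp only [hm, if_true]
    have h1 : m - Finsupp.single i 1 + Finsupp.single i 1 = m :=
      Finsupp.sub_add_single_one_cancel (Finsupp.mem_support_iff.1 hm)
    have h2 := congrArg Finsupp.degree h1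
    rw [map_add, Finsupp.degree_single] at h2
    have h3 : m.degree = n + 1 ↔ (m - Finsupp.single i 1).degree = n := by omega
    simp only [h3]
  · simp [hm]

theorem exists_eq_add_of_lineRestriction_eq_zero {q : Form} {n : ℕ}
    (hq : q.IsHomogeneous (n + 1)) (h : lineRestriction q = 0) :
    ∃ A B : Form, B.IsHomogeneous n ∧ q = X 2 * A + X 3 * B := by
  obtain ⟨A, B, hAB⟩ := Ideal.mem_span_pair.1 (mem_span_X_of_lineRestriction_eq_zero hq h)
  refine ⟨homogeneousComponent n A, homogeneousComponent n B,
    homogeneousComponent_isHomogeneous n B, ?_⟩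
  rw [← homogeneousComponent_succ_X_mul, ← homogeneousComponent_succ_X_mul, ← map_add, mul_comm,
    mul_comm (X 3), hAB, homogeneousComponent_eq_self hq]

/-- A surface through the line `X₂ = X₃ = 0` with fixed tangent plane `X₂ = 0` at its general
point, and with `d - 1` contact arcs based on the line, meets the plane `X₂ = 0` in a multiple of
the line. -/
theorem exists_eq_add_of_hasContactArc {d : ℕ} (hd : 3 ≤ d) {g : Form} (hg : g.IsHomogeneous d)
    (hL : ∀ a b, eval ![a, b, 0, 0] g = 0)
    (h3 : eval ![1, 0, 0, 0] (pderiv 3 g) = 0) (h2 : eval ![1, 0, 0, 0] (pderiv 2 g) ≠ 0)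
    (T : Finset ℂ) (hT : T.card = d - 1)
    (harc : ∀ t ∈ T, ∃ b : ℂ, b ≠ 0 ∧ HasContactArc d g ![b * t, b, 0, 0]) :
    ∃ (H : Form) (c : ℂ), c ≠ 0 ∧ g = X 2 * H + X 3 ^ d * C c := by
  have hsm : ∀ b t : ℂ, (![b * t, b, 0, 0] : Fin 4 → ℂ) = b • ![t, 1, 0, 0] := fun b t => by
    simp [Matrix.smul_cons]
  have hg' : ∀ i, (pderiv i g).IsHomogeneous (d - 1) := fun i => hg.pderiv
  have hsing : ∀ i, ∀ t ∈ T, (lineRestriction (pderiv i g)).eval t = 0 := fun i t ht => by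
    obtain ⟨b, hb, γ, hγ0, -, -, -, hgp⟩ := harc t ht
    have hγ : (fun i => (γ i).coeff 0) = ![b * t, b, 0, 0] := funext hγ0
    have h := (dvd_pow_self Polynomial.X (by omega : d - 1 ≠ 0)).trans (hgp i)
    rw [Polynomial.X_dvd_iff, coeff_zero_aeval, hγ, hsm, eval_smul_of_isHomogeneous (hg' i)] at h
    rw [eval_lineRestriction]
    exact (mul_eq_zero.1 h).resolve_left (pow_ne_zero _ hb)
  -- The zero at infinity makes the degree less than `d - 1`, while there are `d - 1` roots.
  have hzero3 : lineRestriction (pderiv 3 g) = 0 := by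
    refine Polynomial.eq_zero_of_degree_lt_of_eval_finset_eq_zero T ?_ (hsing 3)
    rw [hT, Polynomial.degree_lt_iff_coeff_zero]
    intro m hm
    rcases hm.eq_or_lt with rfl | hm
    · rw [coeff_lineRestriction (hg' 3), h3]
    · exact Polynomial.coeff_eq_zero_of_natDegree_lt
        ((natDegree_lineRestriction_le (hg' 3)).trans_lt hm)
  -- A double root at `t` would give the restriction of `∂₂g` at least `d` roots with multiplicity.
  have hA : ∀ t ∈ T, ∀ b : ℂ, b ≠ 0 →
      eval ![b * t, b, 0, 0] (pderiv 0 (pderiv 2 g)) ≠ 0 := fun t ht b hb h => by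
    rw [hsm, eval_smul_of_isHomogeneous (hg' 2).pderiv, ← eval_lineRestriction,
      ← derivative_lineRestriction] at h
    have h' := (mul_eq_zero.1 h).resolve_left (pow_ne_zero _ hb)
    set p := lineRestriction (pderiv 2 g) with hp
    have hp0 : p ≠ 0 := fun h0 => h2 (by
      rw [← coeff_lineRestriction (hg' 2), ← hp, h0, Polynomial.coeff_zero])
    have hmult : 1 < p.rootMultiplicity t :=
      (Polynomial.one_lt_rootMultiplicity_iff_isRoot hp0).2 ⟨hsing 2 t ht, h'⟩
    have hle : T.val ≤ p.roots := (Multiset.le_iff_subset T.nodup).2 fun s hs =>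
      (Polynomial.mem_roots hp0).2 (hsing 2 s hs)
    have hlt : t ::ₘ T.val ≤ p.roots := by
      rw [Multiset.le_iff_count]
      intro s
      rcases eq_or_ne s t with rfl | hst
      · rw [Multiset.count_cons_self, Multiset.count_eq_one_of_mem T.nodup ht,
          Polynomial.count_roots]
        exact hmult
      · rw [Multiset.count_cons_of_ne hst]
        exact Multiset.le_iff_count.1 hle s
    have h1 := Multiset.card_le_card hlt
    have h5 := p.card_roots'
    have h6 : p.natDegree ≤ d - 1 := natDegree_lineRestriction_le (hg' 2)
    rw [Multiset.card_cons, Finset.card_val, hT] at h1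
    omega
  have key : ∀ k ≤ d, ∃ H K : Form, K.IsHomogeneous (d - k) ∧ g = X 2 * H + X 3 ^ k * K := by
    intro k
    induction k with
    | zero => exact fun _ => ⟨0, g, hg, by simp⟩
    | succ k ih =>
      intro hk
      obtain ⟨H, K, hK, hgHK⟩ := ih (by omega)
      have hK0 : lineRestriction K = 0 := by
        -- For `k = 0` the surface contains the line; for `k = 1` the restriction of `K` is that of
        -- `∂₃g`; from `k = 2` on, the arcs give more roots than the degree allows.
        obtain rfl | rfl | hk2 : k = 0 ∨ k = 1 ∨ 2 ≤ k := by omega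
        · refine Polynomial.funext fun t => ?_
          have := hL t 1
          rw [hgHK] at this
          simpa [eval_lineRestriction] using this
        · rw [hgHK] at hzero3
          simpa [lineRestriction, pderiv_X] using hzero3
        · refine Polynomial.eq_zero_of_degree_lt_of_eval_finset_eq_zero T ?_ fun t ht => ?_
          · rw [hT]
            refine (Polynomial.degree_le_of_natDegree_le
              (natDegree_lineRestriction_le hK)).trans_lt ?_
            exact_mod_cast (by omega : d - k < d - 1)
          · obtain ⟨b, hb, hbt⟩ := harc t ht
            have h := coeff_eq_zero_of_hasContactArc hk2 (by omega) hg hgHK hb hbt (hA t ht b hb)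
            rw [hsm, eval_smul_of_isHomogeneous hK] at h
            rw [eval_lineRestriction]
            exact (mul_eq_zero.1 h).resolve_left (pow_ne_zero _ hb)
      rw [show d - k = d - (k + 1) + 1 by omega] at hK
      obtain ⟨A, B, hB, hAB⟩ := exists_eq_add_of_lineRestriction_eq_zero hK hK0
      refine ⟨H + X 3 ^ k * A, B, hB, ?_⟩
      rw [hgHK, hAB]
      ring
  obtain ⟨H, K, hK, hgHK⟩ := key d le_rfl
  rw [Nat.sub_self, ← totalDegree_zero_iff_isHomogeneous, totalDegree_eq_zero_iff_eq_C] at hK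
  refine ⟨H, coeff 0 K, fun hc => ?_, by rw [← hK]; exact hgHK⟩
  obtain ⟨t, ht⟩ : T.Nonempty := Finset.card_pos.1 (by omega)
  obtain ⟨b, hb, hbt⟩ := harc t ht
  refine ne_X_mul_of_hasContactArc hd hbt (hA t ht b hb) (H := H) ?_
  rw [hK, hc, C_0, mul_zero, add_zero] at hgHK
  exact hgHK

/-! ### Linear changes of coordinates -/

/-- The form `f` written in the linear coordinates given by the basis `e`. -/
noncomputable def inCoordinates (e : Module.Basis (Fin 4) ℂ (Fin 4 → ℂ)) (f : Form) : Form :=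
  aeval (fun i => ∑ j, C (e j i) * X j : Fin 4 → Form) f

section InCoordinates

variable (e : Module.Basis (Fin 4) ℂ (Fin 4 → ℂ))

theorem eval_inCoordinates (f : Form) (x : Fin 4 → ℂ) :
    eval x (inCoordinates e f) = eval (∑ j, x j • e j) f := by
  rw [inCoordinates, ← RingHom.coe_coe (aeval _), ← RingHom.comp_apply]
  congr 1
  ext i
  · simp
  · simp [Finset.sum_apply, mul_comm]

theorem eval_equivFun_inCoordinates (f : Form) (y : Fin 4 → ℂ) :
    eval (e.equivFun y) (inCoordinates e f) = eval y f := by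
  rw [eval_inCoordinates, e.sum_equivFun]

theorem eval_equivFun_pderiv_inCoordinates (f : Form) (y : Fin 4 → ℂ) (j : Fin 4) :
    eval (e.equivFun y) (pderiv j (inCoordinates e f)) = ∑ i, eval y (pderiv i f) * e j i := by
  rw [inCoordinates, derivation_aeval, map_sum]
  refine Finset.sum_congr rfl fun i _ => ?_
  rw [map_mul]
  congr 1
  · exact eval_equivFun_inCoordinates e (pderiv i f) y
  · simp [pderiv_X, Pi.single_apply]

theorem isHomogeneous_inCoordinates {f : Form} {d : ℕ} (hf : f.IsHomogeneous d) :
    (inCoordinates e f).IsHomogeneous d := by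
  have := hf.aeval (fun i => ∑ j, C (e j i) * X j : Fin 4 → Form) (n := 1)
    fun i => IsHomogeneous.sum _ _ _ fun j _ => isHomogeneous_C_mul_X _ _
  rwa [one_mul] at this

theorem affineEquation_inCoordinates (f : Form) (b : Module.Basis (Fin 4) ℂ (Fin 4 → ℂ)) :
    affineEquation (inCoordinates e f) (b.map e.equivFun) = affineEquation f b := by
  have hb : ∀ k i, ∑ j, e j i * e.repr (b k) j = b k i := fun k i => by
    simpa [Finset.sum_apply, mul_comm] using congrFun (e.sum_repr (b k)) i
  have hcomp : ∀ (φ ψ : Fin 4 → MvPolynomial (Fin 3) ℂ),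
      (∀ i, ∑ j, C (e j i) * φ j = ψ i) → aeval φ (inCoordinates e f) = aeval ψ f := by
    intro φ ψ h
    rw [inCoordinates, ← AlgHom.comp_apply]
    congr 1
    ext i : 1
    simp only [AlgHom.comp_apply, aeval_X, map_sum, map_mul, aeval_C, algebraMap_eq, h]
  refine hcomp _ _ fun i => ?_
  simp only [Module.Basis.map_apply, Module.Basis.equivFun_apply, mul_add,
    Finset.sum_add_distrib, Finset.mul_sum]
  congr 1
  · rw [← hb 0 i, map_sum]
    simp only [map_mul]
  · rw [Finset.sum_comm]
    refine Finset.sum_congr rfl fun j _ => ?_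
    rw [← hb j.succ i, map_sum, Finset.sum_mul]
    simp only [map_mul, mul_assoc]

theorem hasContactArc_of_isASingularity {d : ℕ} (hd : 3 ≤ d) {f : Form} (hf : f.IsHomogeneous d)
    {P : P3} (hP : IsASingularity (d - 1) f P) :
    ∃ v ∈ P.submodule, v ≠ 0 ∧ HasContactArc d (inCoordinates e f) (e.equivFun v) := by
  obtain ⟨b, hb, z, hz, u, hu, hF⟩ := hP
  rw [Nat.sub_add_cancel (by omega)] at hF
  refine ⟨b 0, hb, b.ne_zero 0, ?_⟩
  rw [← Module.Basis.map_apply]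
  exact hasContactArc_of_affineEquation (by omega) (isHomogeneous_inCoordinates e hf) _ z hz u hu
    (by rw [affineEquation_inCoordinates, hF])

end InCoordinates

/-! ### Tangent planes along `Λ` and adapted coordinates -/

theorem mem_tangentSpace {f : Form} {P : P3} {v : Fin 4 → ℂ} :
    v ∈ tangentSpace f P ↔ ∑ i, eval P.rep (pderiv i f) * v i = 0 := by
  simp [tangentSpace, LinearMap.sum_apply]

theorem mk_eq_of_mem_submodule {P : P3} {v : Fin 4 → ℂ} (hv : v ∈ P.submodule) (hv0 : v ≠ 0) :
    Projectivization.mk ℂ v hv0 = P := by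
  rw [Projectivization.submodule_eq, Submodule.mem_span_singleton] at hv
  obtain ⟨c, hc⟩ := hv
  rw [← P.mk_rep, Projectivization.mk_eq_mk_iff']
  exact ⟨c, hc⟩

theorem rep_mem_submodule (P : P3) : P.rep ∈ P.submodule := by
  rw [Projectivization.submodule_eq]
  exact Submodule.mem_span_singleton_self _

theorem submodule_le_of_mem {Λ : Projectivization.Subspace ℂ (Fin 4 → ℂ)} {P : P3}
    (hP : P ∈ Λ) : P.submodule ≤ Λ.submodule := by
  rw [Projectivization.submodule_eq, Submodule.span_singleton_le_iff_mem,
    Projectivization.Subspace.mem_submodule_iff _ P.rep_nonzero, P.mk_rep]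
  exact hP

theorem eval_eq_zero_of_mem_line {d : ℕ} (hd : d ≠ 0) {f : Form} (hf : f.IsHomogeneous d)
    {Λ : Projectivization.Subspace ℂ (Fin 4 → ℂ)} (hΛ : ∀ P ∈ Λ, OnSurface f P)
    {v : Fin 4 → ℂ} (hv : v ∈ Λ.submodule) : eval v f = 0 := by
  rcases eq_or_ne v 0 with rfl | hv0
  · have := eval_smul_of_isHomogeneous hf 0 0
    simpa [hd] using this
  · obtain ⟨c, hc⟩ := Projectivization.exists_smul_eq_mk_rep ℂ v hv0
    have h : eval (Projectivization.mk ℂ v hv0).rep f = 0 := hΛ _ (hv hv0)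
    rw [← hc, Units.smul_def, eval_smul_of_isHomogeneous hf] at h
    exact (mul_eq_zero.1 h).resolve_left (pow_ne_zero _ c.ne_zero)

/-- For `v` on the line, `f` vanishes identically on `P + tv`; the coefficient of `t` is the
tangency condition. -/
theorem line_le_tangentSpace {d : ℕ} (hd : d ≠ 0) {f : Form} (hf : f.IsHomogeneous d)
    {Λ : Projectivization.Subspace ℂ (Fin 4 → ℂ)} (hΛ : ∀ P ∈ Λ, OnSurface f P)
    {P : P3} (hP : P ∈ Λ) : Λ.submodule ≤ tangentSpace f P := by
  intro v hv
  set γ : Fin 4 → Polynomial ℂ :=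
    fun i => Polynomial.C (P.rep i) + Polynomial.C (v i) * Polynomial.X with hγ
  have h0 : aeval γ f = 0 := by
    refine Polynomial.funext fun t => ?_
    have e : (aeval γ f).eval t = eval (P.rep + t • v) f := by
      rw [← Polynomial.coe_evalRingHom, ← RingHom.coe_coe (aeval γ), ← RingHom.comp_apply]
      congr 1
      ext i
      · simp
      · simp [hγ, mul_comm (v _)]
    rw [e, Polynomial.eval_zero]
    exact eval_eq_zero_of_mem_line hd hf hΛ (Submodule.add_mem _
      (submodule_le_of_mem hP (rep_mem_submodule P)) (Submodule.smul_mem _ t hv))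
  have h1 := coeff_one_aeval γ f
  rw [h0, Polynomial.coeff_zero] at h1
  have hc0 : (fun i => (γ i).coeff 0) = P.rep := funext fun i => by simp [hγ]
  have hc1 : ∀ i, (γ i).coeff 1 = v i := fun i => by simp [hγ, Polynomial.coeff_C_succ]
  simp only [hc0, hc1] at h1
  exact mem_tangentSpace.2 h1.symm

/-- Linear coordinates adapted to a flag consisting of a point, a line and a plane. -/
theorem exists_adapted_basis {L W : Submodule ℂ (Fin 4 → ℂ)} (hLW : L ≤ W)
    (hL : Module.finrank ℂ L = 2) (hW : Module.finrank ℂ W = 3) {v : Fin 4 → ℂ} (hv : v ∈ L)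
    (hv0 : v ≠ 0) :
    ∃ e : Module.Basis (Fin 4) ℂ (Fin 4 → ℂ), e 0 = v ∧ e 1 ∈ L ∧ e 3 ∈ W ∧
      ∀ y ∈ L, e.equivFun y 2 = 0 ∧ e.equivFun y 3 = 0 := by
  obtain ⟨v1, hv1, hv1'⟩ : ∃ v1 ∈ L, v1 ∉ Submodule.span ℂ {v} := by
    by_contra! h
    have := Submodule.finrank_mono (show L ≤ Submodule.span ℂ {v} from h)
    have := finrank_span_singleton (K := ℂ) hv0
    omega
  obtain ⟨v3, hv3, hv3'⟩ : ∃ v3 ∈ W, v3 ∉ L := by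
    by_contra! h
    have := Submodule.finrank_mono (show W ≤ L from h)
    omega
  obtain ⟨v2, hv2⟩ : ∃ v2, v2 ∉ W := by
    by_contra! h
    have h1 : W = ⊤ := Submodule.eq_top_iff'.2 h
    rw [h1, finrank_top, Module.finrank_fin_fun] at hW
    omega
  have smul_eq : ∀ (U : Submodule ℂ (Fin 4 → ℂ)) (c : ℂ) (w : Fin 4 → ℂ), w ∉ U → c • w ∈ U →
      c = 0 := fun U c w hw hc => by
    by_contra h
    exact hw ((U.smul_mem_iff h).1 hc)
  have hmem : ∀ a b c d : ℂ, a • v + b • v1 + c • v2 + d • v3 ∈ L → c = 0 ∧ d = 0 := by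
    intro a b c d h
    have hab : a • v + b • v1 ∈ L := L.add_mem (L.smul_mem _ hv) (L.smul_mem _ hv1)
    have hc : c = 0 := by
      refine smul_eq W c v2 hv2 ?_
      have := W.sub_mem (W.sub_mem (hLW h) (hLW hab)) (W.smul_mem d hv3)
      convert this using 1
      abel
    subst hc
    refine ⟨rfl, smul_eq L d v3 hv3' ?_⟩
    have := L.sub_mem h hab
    convert this using 1
    simp
  have hli : LinearIndependent ℂ ![v, v1, v2, v3] := by
    rw [Fintype.linearIndependent_iff]
    intro c hc
    rw [Fin.sum_univ_four] at hc
    change c 0 • v + c 1 • v1 + c 2 • v2 + c 3 • v3 = 0 at hc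
    obtain ⟨h2, h3⟩ := hmem (c 0) (c 1) (c 2) (c 3) (hc ▸ L.zero_mem)
    rw [h2, h3, zero_smul, zero_smul, add_zero, add_zero] at hc
    have h1 : c 1 = 0 := by
      refine smul_eq _ (c 1) v1 hv1' ?_
      rw [eq_neg_of_add_eq_zero_right hc]
      exact Submodule.neg_mem _ (Submodule.smul_mem _ _ (Submodule.mem_span_singleton_self v))
    rw [h1, zero_smul, add_zero] at hc
    have h0 : c 0 = 0 := (smul_eq_zero.1 hc).resolve_right hv0
    intro i
    fin_cases i <;> assumption
  let e := basisOfLinearIndependentOfCardEqFinrank hli (by simp)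
  have he : ∀ i, e i = ![v, v1, v2, v3] i := fun i => by simp [e]
  refine ⟨e, he 0, (he 1).symm ▸ hv1, (he 3).symm ▸ hv3, fun y hy => ?_⟩
  have h := e.sum_equivFun y
  rw [Fin.sum_univ_four, he, he, he, he] at h
  exact hmem _ _ _ _ (h.symm ▸ hy)

theorem finrank_tangentSpace {f : Form} {P : P3} {i : Fin 4}
    (hi : eval P.rep (pderiv i f) ≠ 0) : Module.finrank ℂ (tangentSpace f P) = 3 := by
  set α : (Fin 4 → ℂ) →ₗ[ℂ] ℂ :=
    ∑ i, eval P.rep (pderiv i f) • (LinearMap.proj i : (Fin 4 → ℂ) →ₗ[ℂ] ℂ) with hα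
  have hα0 : α ≠ 0 := fun h => hi (by
    have := LinearMap.congr_fun h (Pi.single i 1)
    simpa [hα, LinearMap.sum_apply, Pi.single_apply] using this)
  have h1 := LinearMap.finrank_range_add_finrank_ker α
  rw [LinearMap.range_eq_top.2 (LinearMap.surjective hα0), finrank_top, Module.finrank_self,
    Module.finrank_fin_fun] at h1
  change Module.finrank ℂ (LinearMap.ker α) = 3
  omega

end StarPoint

/-! ### The general point of `Λ` -/

theorem mainTheorem6 (d : ℕ) (hd : 3 ≤ d)
    (f : StarPoint.Form) (hf0 : f ≠ 0) (hf : f.IsHomogeneous d)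
    (Λ : Projectivization.Subspace ℂ (Fin 4 → ℂ))
    (hline : Module.finrank ℂ Λ.submodule = 2)
    (hΛX : ∀ P ∈ Λ, StarPoint.OnSurface f P)
    (hΛsing : ¬ ∀ P ∈ Λ, StarPoint.IsSingularPoint f P)
    (hA : ∃ S : Finset StarPoint.P3, S.card = d - 1 ∧
      ∀ P ∈ S, P ∈ Λ ∧ StarPoint.IsASingularity (d - 1) f P) :
    StarPoint.HoldsAtGeneralPoint (Λ : Set StarPoint.P3) (StarPoint.IsStarPoint f) := by
  open StarPoint in
  have hd0 : d ≠ 0 := by omega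
  obtain ⟨P₀, hP₀, i, hi⟩ : ∃ P ∈ Λ, ∃ i, eval P.rep (pderiv i f) ≠ 0 := by
    by_contra! h
    exact hΛsing fun P hP => ⟨hΛX P hP, h P hP⟩
  have hLT : ∀ P ∈ Λ, Λ.submodule ≤ tangentSpace f P := fun P hP =>
    line_le_tangentSpace hd0 hf hΛX hP
  obtain ⟨e, he0, he1, he3, hcoord⟩ := exists_adapted_basis (hLT P₀ hP₀) hline
    (finrank_tangentSpace hi) (submodule_le_of_mem hP₀ (rep_mem_submodule P₀)) P₀.rep_nonzero
  set g := inCoordinates e f with hg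
  have hgh : g.IsHomogeneous d := isHomogeneous_inCoordinates e hf
  have hpd : ∀ (P : P3) j, eval (e.equivFun P.rep) (pderiv j g) = 0 ↔ e j ∈ tangentSpace f P :=
    fun P j => by rw [eval_equivFun_pderiv_inCoordinates, mem_tangentSpace]
  have hvec : ∀ y ∈ Λ.submodule, e.equivFun y = ![e.equivFun y 0, e.equivFun y 1, 0, 0] := by
    intro y hy
    ext k
    fin_cases k
    · rfl
    · rfl
    · exact (hcoord y hy).1
    · exact (hcoord y hy).2
  have hsum : ∀ a b : ℂ, ∑ j, (![a, b, 0, 0] : Fin 4 → ℂ) j • e j = a • e 0 + b • e 1 :=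
    fun a b => by simp [Fin.sum_univ_four]
  have he0L : e 0 ∈ Λ.submodule := he0 ▸ submodule_le_of_mem hP₀ (rep_mem_submodule P₀)
  have hL : ∀ a b, eval ![a, b, 0, 0] g = 0 := fun a b => by
    rw [eval_inCoordinates, hsum]
    exact eval_eq_zero_of_mem_line hd0 hf hΛX
      (Submodule.add_mem _ (Submodule.smul_mem _ _ he0L) (Submodule.smul_mem _ _ he1))
  -- at a point whose tangent plane is defined, `e 2` is transversal to it
  have htrans : ∀ P ∈ Λ, eval P.rep (pderiv i f) ≠ 0 → e 3 ∈ tangentSpace f P →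
      e 2 ∉ tangentSpace f P := fun P hP hne h3 h2 => hne (by
    have hall : ∀ j, e j ∈ tangentSpace f P := by
      intro j
      fin_cases j
      · exact hLT P hP he0L
      · exact hLT P hP he1
      · exact h2
      · exact h3
    have h : (Pi.single i 1 : Fin 4 → ℂ) ∈ tangentSpace f P := by
      rw [← e.sum_equivFun (Pi.single i 1)]
      exact Submodule.sum_mem _ fun j _ => Submodule.smul_mem _ _ (hall j)
    simpa [mem_tangentSpace, Pi.single_apply] using h)
  have hP₀c : e.equivFun P₀.rep = ![1, 0, 0, 0] := by
    rw [← he0]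
    ext k
    fin_cases k <;> simp
  have hg3 : eval ![1, 0, 0, 0] (pderiv 3 g) = 0 := by rw [← hP₀c, hpd]; exact he3
  have hg2 : eval ![1, 0, 0, 0] (pderiv 2 g) ≠ 0 := by
    rw [← hP₀c, Ne, hpd]
    exact htrans P₀ hP₀ hi he3
  obtain ⟨S, hScard, hS⟩ := hA
  have hpt : ∀ P ∈ S, ∃ t b : ℂ, b ≠ 0 ∧ HasContactArc d g ![b * t, b, 0, 0] ∧
      t • e 0 + e 1 ∈ P.submodule := by
    intro P hP
    obtain ⟨v, hvP, hv0, harc⟩ := hasContactArc_of_isASingularity e hd hf (hS P hP).2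
    have hvL := submodule_le_of_mem (hS P hP).1 hvP
    have hvsum : e.equivFun v 0 • e 0 + e.equivFun v 1 • e 1 = v := by
      rw [← hsum, ← hvec v hvL, e.sum_equivFun]
    rw [hvec v hvL] at harc
    generalize e.equivFun v 0 = a, e.equivFun v 1 = b at harc hvsum
    -- `b = 0` would make the singular point equal to `P₀`, where `∂₂g ≠ 0`.
    have hb : b ≠ 0 := by
      rintro rfl
      rw [zero_smul, add_zero] at hvsum
      have ha : a ≠ 0 := by rintro rfl; exact hv0 (by rw [← hvsum, zero_smul])
      obtain ⟨γ, hγ0, -, -, -, hgp⟩ := harc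
      have h := (dvd_pow_self Polynomial.X (by omega : d - 1 ≠ 0)).trans (hgp 2)
      rw [Polynomial.X_dvd_iff, coeff_zero_aeval, funext hγ0,
        show (![a, 0, 0, 0] : Fin 4 → ℂ) = a • ![1, 0, 0, 0] by simp [Matrix.smul_cons],
        eval_smul_of_isHomogeneous hgh.pderiv] at h
      exact hg2 ((mul_eq_zero.1 h).resolve_left (pow_ne_zero _ ha))
    refine ⟨a / b, b, hb, by rwa [mul_div_cancel₀ _ hb], ?_⟩
    rw [← Submodule.smul_mem_iff _ hb, smul_add, smul_smul, mul_div_cancel₀ _ hb, hvsum]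
    exact hvP
  choose! t b hb harc hmem using hpt
  have hinj : Set.InjOn t S := by
    intro P hP Q hQ hPQ
    have h1 := hmem P hP
    have h2 := hmem Q hQ
    rw [← hPQ] at h2
    have h0 : t P • e 0 + e 1 ≠ 0 := fun h => by
      have := congrArg (fun y => e.equivFun y 1) h
      simp at this
    rw [← mk_eq_of_mem_submodule h1 h0, ← mk_eq_of_mem_submodule h2 h0]
  obtain ⟨H, c, hc, hgH⟩ := exists_eq_add_of_hasContactArc hd hgh hL hg3 hg2 (S.image t)
    (by rw [Finset.card_image_of_injOn hinj, hScard]) (by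
      intro s hs
      obtain ⟨P, hP, rfl⟩ := Finset.mem_image.1 hs
      exact ⟨b P, hb P hP, harc P hP⟩)
  have hplane : ∀ y, e.equivFun y 2 = 0 → eval y f = e.equivFun y 3 ^ d * c := fun y hy => by
    rw [← eval_equivFun_inCoordinates e, ← hg, hgH]
    simp only [map_add, map_mul, map_pow, eval_X, eval_C, hy, zero_mul, zero_add]
  -- The partial that is nonzero at `P₀` cuts out the open set, all of whose points on `Λ` are
  -- smooth on `X`.
  refine ⟨pderiv i f, d - 1, hf.pderiv, ⟨P₀, hP₀, hi⟩, fun P hP hne => ?_⟩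
  have hPL := submodule_le_of_mem hP
  have hPrep := hcoord _ (hPL (rep_mem_submodule P))
  have h3T : e 3 ∈ tangentSpace f P := by
    rw [← hpd, hgH]
    have : d - 1 ≠ 0 := by omega
    simp only [Derivation.leibniz, Derivation.leibniz_pow, map_add, map_mul, map_pow, eval_X,
      smul_eq_mul, nsmul_eq_mul, map_natCast, pderiv_C, hPrep.1, hPrep.2, zero_pow this,
      pderiv_X_of_ne (show (2 : Fin 4) ≠ 3 by decide), map_zero, zero_mul, mul_zero,
      add_zero]
  refine ⟨⟨hΛX P hP, i, hne⟩, hPL.trans (hLT P hP), ⟨e 3, h3T, ?_⟩, fun w hw v hv => ?_⟩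
  · rw [hplane _ (by simp)]
    simpa using hc
  -- The tangent plane contains `e 0`, `e 1`, `e 3` but not `e 2`, so it is `X₂ = 0`. There the
  -- equation is `cX₃ᵈ`, unchanged by translation along `Λ`.
  · have hw2 : e.equivFun w 2 = 0 := by
      by_contra h
      refine htrans P hP hne h3T ((Submodule.smul_mem_iff _ h).1 ?_)
      have hs := e.sum_equivFun w
      rw [Fin.sum_univ_four] at hs
      have e2 : e.equivFun w 2 • e 2 = w - e.equivFun w 0 • e 0 - e.equivFun w 1 • e 1
          - e.equivFun w 3 • e 3 := by
        rw [eq_sub_iff_add_eq, eq_sub_iff_add_eq, eq_sub_iff_add_eq]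
        conv_rhs => rw [← hs]
        abel
      rw [e2]
      exact Submodule.sub_mem _ (Submodule.sub_mem _ (Submodule.sub_mem _ hw
        (Submodule.smul_mem _ _ (hLT P hP he0L))) (Submodule.smul_mem _ _ (hLT P hP he1)))
        (Submodule.smul_mem _ _ h3T)
    have hv' := hcoord v (hPL hv)
    rw [hplane w hw2, hplane (w + v) (by rw [map_add, Pi.add_apply, hw2, hv'.1, add_zero]),
      map_add, Pi.add_apply, hv'.2, add_zero]
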